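/- Let $p\in\mathbb N_0=\{0,1,2,\dots\}$, $\eta>0$ and $\psi\in\mathbb R$. Write $\epsilon_0=1$ and $\epsilon_n=2$ for $n\ge1$, $(a)_n=\prod_{i=1}^n(a+i-1)$, and let $\Psi=\Gamma'/\Gamma$ be the digamma function. For $k\in\mathbb N_0$, $\mu\in\mathbb Z$ and $z>1$ let $$P_k^{\mu}(z)=\Big(\frac{z+1}{z-1}\Big)^{\mu/2}\sum_{j=0}^{k}\frac{(-k)_j\,(k+1)_j}{j!\;\Gamma(1-\mu+j)}\Big(\frac{1-z}{2}\Big)^j ,\qquad \frac1{\Gamma(-m)}:=0\ (m\in\mathbb N_0),$$ be the associated Legendre function of the first kind, i.e. $P_k^\mu(z)=\frac{1}{\Gamma(1-\mu)}\big(\frac{z+1}{z-1}\big)^{\mu/2}{}_2F_1\big(-k,k+1;1-\mu;\frac{1-z}2\big)$, understood by continuity in $\mu$ when $\mu\ge1$. Empty sums are $0$. Then $$ \begin{aligned} (\cosh\eta-\cos\psi)^p\log(\cosh\eta-\cos\psi) ={}&(\eta-\log2)(\cosh\eta-\cos\psi)^p\\ &+p!\,\sinh^p\eta\sum_{n=0}^{p}\frac{(-1)^n\epsilon_n\cos(n\psi)}{(p+n)!}\big[2\Psi(2p+1)-\Psi(p+1+n)-\Psi(p+1-n)\big]P_p^n(\coth\eta)\\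 &+(-1)^pp!\,\sinh^p\eta\sum_{n=0}^{p-1}\frac{\epsilon_n\cos(n\psi)}{(p+n)!}\sum_{k=0}^{p-n-1}\frac{(-1)^k(2n+2k+1)\Big[1+\frac{k!\,(p+n)!}{(2n+k)!\,(p-n)!}\Big]}{(p-n-k)(p+n+k+1)}P_{n+k}^n(\coth\eta)\\ &+2(-1)^pp!\,\sinh^p\eta\sum_{n=1}^{p}\frac{(-1)^n\cos(n\psi)}{(p-n)!}\sum_{k=0}^{n-1}\frac{(-1)^k(2k+1)}{(p-k)(p+k+1)}P_k^{-n}(\coth\eta)\\ &+2(-1)^{p+1}p!\,\sinh^p\eta\sum_{n=p+1}^{\infty}\cos(n\psi)\,(n-p-1)!\,P_p^{-n}(\coth\eta), \end{aligned} $$ where the infinite series converges absolutely, and where $$(\cosh\eta-\cos\psi)^p=\sinh^p\eta\sum_{n=0}^{p}\epsilon_n\cos(n\psi)\,\frac{(-p)_n\,(p-n)!}{(p+n)!}\,P_p^n(\coth\eta),$$ so that this is the Fourier cosine series in $\psi$ of $(\cosh\eta-\cos\psi)^p\log(\cosh\eta-\cos\psi)$. -/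

import Mathlib

noncomputable section

/-- The real digamma function `ψ = Γ' / Γ`, as the restriction of `Complex.digamma` to `ℝ`. -/
def realDigamma (x : ℝ) : ℝ := (Complex.digamma (x : ℂ)).re

/-- The hyperbolic cotangent. -/
def hypCoth (x : ℝ) : ℝ := Real.cosh x / Real.sinh x

/-- The Neumann factor `ε_n = 2 - δ_{n,0}`. -/
def neumannFactor (n : ℕ) : ℝ := if n = 0 then 1 else 2

/-- The regularized Gauss hypergeometric series
`₂F₁(a, b; c; x) / Γ(c) = ∑ k, (a)_k (b)_k / (k! Γ(c + k)) x^k`, with `1 / Γ = 0` at the poles of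
`Γ`; it is entire in `c`. (Mathlib's `Real.Gamma` takes the value `0` at the poles, so that the
quotient below is `0` there, as it should be.) -/
def regHypergeometric (a b c x : ℝ) : ℝ :=
  ∑' k : ℕ, (ascPochhammer ℝ k).eval a * (ascPochhammer ℝ k).eval b /
    ((k.factorial : ℝ) * Real.Gamma (c + k)) * x ^ k

/-- The associated Legendre function of the first kind on `(1, ∞)`, of degree `p ∈ ℕ₀` and integer
order `μ`:
`P_p^μ(z) = ((z+1)/(z-1))^{μ/2} / Γ(1-μ) · ₂F₁(-p, p+1; 1-μ; (1-z)/2)`,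
where `₂F₁ / Γ(1-μ)` is the regularized series. For these degrees the series terminates, so that it
represents the function for all `z > 1`. -/
def assocLegendreP (p : ℕ) (μ : ℤ) (z : ℝ) : ℝ :=
  ((z + 1) / (z - 1)) ^ ((μ : ℝ) / 2) *
    regHypergeometric (-(p : ℝ)) ((p : ℝ) + 1) (1 - (μ : ℝ)) ((1 - z) / 2)

theorem ascPochhammer_mul_Gamma (c : ℝ) (hc : ∀ m : ℕ, c ≠ -(m : ℝ)) (k : ℕ) :
    (ascPochhammer ℝ k).eval c * Real.Gamma c = Real.Gamma (c + k) := by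
  induction k with
  | zero => simp
  | succ k ih =>
    have h : c + k ≠ 0 := fun h => hc k (by linarith)
    rw [ascPochhammer_succ_eval, Nat.cast_succ, ← add_assoc, Real.Gamma_add_one h, ← ih]
    ring

/-- Away from the poles of `Γ`, the regularized series is Mathlib's `₂F₁` divided by `Γ(c)`. -/
theorem regHypergeometric_eq (a b c x : ℝ) (hc : ∀ m : ℕ, c ≠ -(m : ℝ)) :
    regHypergeometric a b c x = ordinaryHypergeometric a b c x / Real.Gamma c := by
  have hG : Real.Gamma c ≠ 0 := Real.Gamma_ne_zero hc
  rw [regHypergeometric, ordinaryHypergeometric_eq_tsum, ← tsum_div_const]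
  refine tsum_congr fun k => ?_
  rw [← ascPochhammer_mul_Gamma c hc k, smul_eq_mul]
  simp only [div_eq_mul_inv, mul_inv]
  ring

/-- For a degree in `ℕ₀` the defining series is a finite sum. -/
theorem assocLegendreP_eq_sum (p : ℕ) (μ : ℤ) (z : ℝ) :
    assocLegendreP p μ z = ((z + 1) / (z - 1)) ^ ((μ : ℝ) / 2) *
      ∑ k ∈ Finset.range (p + 1),
        (ascPochhammer ℝ k).eval (-(p : ℝ)) * (ascPochhammer ℝ k).eval ((p : ℝ) + 1) /
          ((k.factorial : ℝ) * Real.Gamma (1 - (μ : ℝ) + k)) * ((1 - z) / 2) ^ k := by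
  rw [assocLegendreP, regHypergeometric, tsum_eq_sum]
  intro k hk
  have hk' : p < k := by simpa [Nat.lt_succ_iff] using hk
  rw [ascPochhammer_eval_neg_coe_nat_of_lt hk']
  simp

end

/-!
Put `q = exp (-η)`, `x = q ^ 2` and `w = -q * exp (i ψ)`. Then `2 q (cosh η - cos ψ) = |1 + w| ^ 2`
and `2 q sinh η = 1 - x`, so that, up to the factor `(2 q) ^ p`, the function to be expanded is
`|1 + w| ^ (2 p) (η - log 2) + 2 Re ((1 + conj w) ^ p (1 + w) ^ p log (1 + w))`.

The Taylor coefficients `logBinom p a` of `(1 + w) ^ p log (1 + w)` are the derivatives of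
`ν ↦ ν.choose a` at `ν = p`. They obey Pascal's rule, just as the binomial coefficients do, and are
known in closed form (`logBinom_of_le`, `logBinom_of_lt`). Multiplying the Taylor series by the
polynomial `(1 + conj w) ^ p` and collecting the terms with a given power of `exp (i ψ)` gives a
cosine series whose coefficients are finite sums over `logBinom` (`hasSum_cos_of_hasSum`).

It remains to recognise these finite sums as Legendre functions. With `μ = ∓ n`, the function
`(1 - x) ^ p P_l^μ (coth η)` is `q ^ n` times a homogeneous polynomial in `x` and `1 - x`. Sums over
an array with Pascal's rule can be rewritten in that form by two Vandermonde-type identities, one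
suited to the order `-n` (`IsPascal.sum_choose_mul`) and one to the order `n`
(`IsPascal.sum_choose_add_mul`).

* For the binomial coefficients themselves this gives the expansion of the power
  (`cosh_sub_cos_pow`) and the relation between the orders `n` and `-n`
  (`assocLegendreP_natCast_eq_neg`).
* For `logBinom` and `n > p` it gives `P_p^{-n}` at once (`sum_choose_mul_logBinom_of_lt`).
* For `logBinom` and `n ≤ p` harmonic numbers depending on the summation index appear. They are
  traded for a sum over lower degrees `l < p` by `legendreCoeff_mul_harmonic`, the one summation
  identity needed, which comes from a two-term recurrence and a telescoping sum.
-/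

open Finset

/-! ### Pascal-type arrays and the Legendre coefficients -/

/-- A two-parameter family obeying Pascal's rule. The column `a = 0` is constant in `p`, which is the
same rule with value `0` to the left of the array. -/
structure IsPascal (f : ℕ → ℕ → ℝ) : Prop where
  zero : ∀ p, f (p + 1) 0 = f p 0
  succ : ∀ p a, f (p + 1) (a + 1) = f p a + f p (a + 1)

/-- The Taylor coefficients of `(1 + w) ^ p * log (1 + w)`, equivalently the derivative of the
binomial coefficient `ν.choose a` in `ν` at `ν = p`. They are defined by Pascal's rule in `p`; for
`p = 0` they are those of `log (1 + w)`, where division by zero gives the right value at `a = 0`. -/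
noncomputable def logBinom : ℕ → ℕ → ℝ
  | 0, a => (-1) ^ (a + 1) / a
  | _ + 1, 0 => 0
  | p + 1, a + 1 => logBinom p a + logBinom p (a + 1)

theorem logBinom_zero_right (p : ℕ) : logBinom p 0 = 0 := by
  cases p <;> simp [logBinom]

theorem isPascal_logBinom : IsPascal logBinom where
  zero p := by simp [logBinom_zero_right]
  succ p a := by rw [logBinom]

theorem isPascal_choose : IsPascal (fun p a => (p.choose a : ℝ)) where
  zero p := by simp
  succ p a := by simp [Nat.choose_succ_succ]

theorem logBinom_of_lt (p m : ℕ) :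
    logBinom p (p + 1 + m) =
      (-1) ^ m * (p.factorial * m.factorial : ℝ) / ((p + 1 + m).factorial : ℝ) := by
  induction p generalizing m with
  | zero =>
    have : (m.factorial : ℝ) ≠ 0 := by positivity
    rw [logBinom, show 0 + 1 + m = m + 1 by ring, Nat.factorial_succ]
    push_cast
    field_simp
    simp [pow_succ]
  | succ p ih =>
    rw [show p + 1 + 1 + m = (p + 1 + m) + 1 by ring, logBinom, ih,
      show p + 1 + m + 1 = p + 1 + (m + 1) by ring, ih,
      show p + 1 + (m + 1) = p + 1 + m + 1 by ring]
    have : ((p + 1 + m).factorial : ℝ) ≠ 0 := by positivity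
    simp only [Nat.factorial_succ (p + 1 + m), Nat.factorial_succ m, Nat.factorial_succ p]
    push_cast
    have : (p : ℝ) + 1 + m + 1 ≠ 0 := by positivity
    field_simp
    ring

theorem logBinom_of_le (p a : ℕ) (h : a ≤ p) :
    logBinom p a = p.choose a * ((harmonic p : ℝ) - harmonic (p - a)) := by
  induction p generalizing a with
  | zero => simp [Nat.le_zero.1 h, logBinom_zero_right]
  | succ p ih =>
    cases a with
    | zero => simp [logBinom_zero_right]
    | succ a =>
      rw [logBinom, ih a (by omega), Nat.add_sub_add_right]
      rcases Nat.lt_or_ge a p with h1 | h1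
      · obtain ⟨d, rfl⟩ := Nat.exists_eq_add_of_le (Nat.succ_le_of_lt h1)
        rw [ih (a + 1) h1, show a.succ + d - a = d + 1 by omega,
          show a.succ + d - (a + 1) = d by omega, harmonic_succ, harmonic_succ]
        have h2 := Nat.choose_mul_succ_eq (a.succ + d) (a + 1)
        rw [show a.succ + d + 1 - (a + 1) = d + 1 by omega, Nat.choose_succ_succ] at h2
        rw [Nat.choose_succ_succ]
        have h2' : (((a.succ + d).choose (a + 1) : ℕ) : ℝ) * ((a : ℝ) + 1 + d + 1) =
            ((a.succ + d).choose a + (a.succ + d).choose (a + 1)) * ((d : ℝ) + 1) := by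
          exact_mod_cast h2
        have : (d : ℝ) + 1 ≠ 0 := by positivity
        have : (a : ℝ) + 1 + d + 1 ≠ 0 := by positivity
        push_cast
        simp only [Nat.succ_eq_add_one] at *
        field_simp
        linear_combination h2'
      · obtain rfl : a = p := by omega
        have h2 := logBinom_of_lt a 0
        rw [add_zero] at h2
        rw [h2, harmonic_succ, Nat.factorial_succ]
        have : (a.factorial : ℝ) ≠ 0 := by positivity
        simp
        field_simp

/-- Vandermonde's identity, valid for every array with Pascal's rule. -/
theorem IsPascal.sum_antidiagonal {f : ℕ → ℕ → ℝ} (hf : IsPascal f) (p m k : ℕ) :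
    ∑ r ∈ antidiagonal k, (m.choose r.1 : ℝ) * f p r.2 = f (p + m) k := by
  induction m generalizing k with
  | zero =>
    cases k with
    | zero => simp
    | succ k => simp [Finset.Nat.sum_antidiagonal_succ]
  | succ m ih =>
    cases k with
    | zero =>
      have := ih 0
      simp at this
      simp [this, ← add_assoc, hf.zero]
    | succ k =>
      rw [← add_assoc, hf.succ, ← ih, ← ih, Finset.Nat.sum_antidiagonal_succ,
        Finset.Nat.sum_antidiagonal_succ]
      simp only [Nat.choose_succ_succ, Nat.cast_add, add_mul, sum_add_distrib,
        Nat.choose_zero_right]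
      ring

/-- With `x + s = 1` the left side is a polynomial in `x`, and the right side expands it in the
basis `x ^ i * s ^ (m - i)`; for `f = Nat.choose` this is the Pfaff transformation of a terminating
hypergeometric series. -/
theorem IsPascal.sum_choose_mul {f : ℕ → ℕ → ℝ} (hf : IsPascal f) (x s : ℝ) (m p n : ℕ) :
    ∑ j ∈ range (m + 1), (m.choose j : ℝ) * (f p (n + j) * x ^ j * (x + s) ^ (m - j)) =
      ∑ i ∈ range (m + 1), (m.choose i : ℝ) * (f (p + i) (n + i) * x ^ i * s ^ (m - i)) := by
  induction m generalizing p n with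
  | zero => simp
  | succ m ih =>
    have h1 := sum_choose_succ_mul (fun j k => f p (n + j) * x ^ j * (x + s) ^ k) m
    have h2 := sum_choose_succ_mul (fun i k => f (p + i) (n + i) * x ^ i * s ^ k) m
    rw [h1, h2]
    have e1 : ∑ i ∈ range (m + 1), (m.choose i : ℝ) * (f (p + i) (n + i) * x ^ i * s ^ (m + 1 - i))
        = s * ∑ i ∈ range (m + 1), (m.choose i : ℝ) *
          (f p (n + i) * x ^ i * (x + s) ^ (m - i)) := by
      rw [ih, mul_sum]
      refine sum_congr rfl fun i hi => ?_
      rw [Nat.sub_add_comm (mem_range_succ_iff.1 hi), pow_succ]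
      ring
    have e2 : ∑ i ∈ range (m + 1), (m.choose i : ℝ) *
        (f (p + (i + 1)) (n + (i + 1)) * x ^ (i + 1) * s ^ (m - i))
        = x * ∑ i ∈ range (m + 1), (m.choose i : ℝ) *
          (f (p + 1) (n + 1 + i) * x ^ i * (x + s) ^ (m - i)) := by
      rw [ih, mul_sum]
      refine sum_congr rfl fun i hi => ?_
      rw [pow_succ, show p + (i + 1) = p + 1 + i by ring, show n + (i + 1) = n + 1 + i by ring]
      ring
    rw [e1, e2, mul_sum, mul_sum, ← sum_add_distrib, ← sum_add_distrib]
    refine sum_congr rfl fun i hi => ?_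
    rw [Nat.sub_add_comm (mem_range_succ_iff.1 hi), show n + 1 + i = (n + i) + 1 by ring, hf.succ,
      show n + (i + 1) = n + i + 1 by ring]
    ring

/-- The companion of `IsPascal.sum_choose_mul` in which the shift by `n` sits in the binomial
coefficient and not in `f`. -/
theorem IsPascal.sum_choose_add_mul {f : ℕ → ℕ → ℝ} (hf : IsPascal f) (x s : ℝ) (m p n : ℕ) :
    ∑ j ∈ range (m + 1), ((n + m).choose (n + j) : ℝ) * (f p j * x ^ j * (x + s) ^ (m - j)) =
      ∑ i ∈ range (m + 1), ((n + m).choose (n + i) : ℝ) *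
        (f (p + (n + i)) i * x ^ i * s ^ (m - i)) := by
  have h := sum_range_diag_flip (m + 1) (fun j k => ((n + m).choose (n + j) : ℝ) *
    (f p j * x ^ j * (x ^ k * s ^ (m - j - k) * ((m - j).choose k : ℝ))))
  have h1 : ∀ j ∈ range (m + 1),
      ((n + m).choose (n + j) : ℝ) * (f p j * x ^ j * (x + s) ^ (m - j)) =
      ∑ k ∈ range (m + 1 - j), ((n + m).choose (n + j) : ℝ) *
        (f p j * x ^ j * (x ^ k * s ^ (m - j - k) * ((m - j).choose k : ℝ))) := by
    intro j hj
    rw [add_pow, mul_sum, mul_sum, Nat.sub_add_comm (mem_range_succ_iff.1 hj)]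
  rw [sum_congr rfl h1, ← h]
  refine sum_congr rfl fun i hi => ?_
  rw [← hf.sum_antidiagonal p (n + i) i, sum_mul, sum_mul, mul_sum,
    ← Finset.Nat.sum_antidiagonal_swap, Finset.Nat.sum_antidiagonal_eq_sum_range_succ_mk]
  refine sum_congr rfl fun j hj => ?_
  have hj := mem_range_succ_iff.1 hj
  have hi := mem_range_succ_iff.1 hi
  obtain ⟨k, rfl⟩ := Nat.exists_eq_add_of_le hj
  obtain ⟨d, rfl⟩ := Nat.exists_eq_add_of_le hi
  have hc : ((n + (j + k + d)).choose (n + j) : ℝ) * ((j + k + d - j).choose k : ℝ)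
      = ((n + (j + k + d)).choose (n + (j + k)) : ℝ) * ((n + (j + k)).choose k : ℝ) := by
    have := Nat.choose_mul (n := n + (j + k + d)) (k := n + (j + k)) (s := n + j)
    have e : (n + (j + k)).choose k = (n + (j + k)).choose (n + j) :=
      Nat.choose_symm_of_eq_add (by ring)
    rw [e]
    norm_cast
    rw [this (by omega), show n + (j + k + d) - (n + j) = j + k + d - j by omega,
      show n + (j + k) - (n + j) = k by omega]
  simp only [Prod.swap, Nat.add_sub_cancel_left] at hc ⊢
  rw [show j + k + d - j - k = d by omega, show j + k + d - j = k + d by omega] at *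
  linear_combination (f p j * x ^ j * x ^ k * s ^ d) * hc

/-- The number `(l + i)! / (l - i)!`, which is `0` for `l < i`; up to sign the numerator
`(-l)_i (l + 1)_i` of the hypergeometric series of a Legendre function of degree `l`. -/
noncomputable def legendreCoeff (l i : ℕ) : ℝ :=
  (-1) ^ i * ((ascPochhammer ℝ i).eval (-(l : ℝ)) * (ascPochhammer ℝ i).eval ((l : ℝ) + 1))

theorem legendreCoeff_zero (l : ℕ) : legendreCoeff l 0 = 1 := by simp [legendreCoeff]

theorem legendreCoeff_succ (l i : ℕ) :
    legendreCoeff l (i + 1) = legendreCoeff l i * (((l : ℝ) - i) * (l + 1 + i)) := by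
  simp only [legendreCoeff, ascPochhammer_succ_eval]
  ring

theorem legendreCoeff_of_lt {l i : ℕ} (h : l < i) : legendreCoeff l i = 0 := by
  simp [legendreCoeff, ascPochhammer_eval_neg_coe_nat_of_lt h]

theorem legendreCoeff_eq (i d : ℕ) :
    legendreCoeff (i + d) i = (2 * i + d).factorial / d.factorial := by
  induction i generalizing d with
  | zero =>
    have : (d.factorial : ℝ) ≠ 0 := by positivity
    simp [legendreCoeff_zero, this]
  | succ i ih =>
    have := ih (d + 1)
    rw [show i + 1 + d = i + (d + 1) by ring, legendreCoeff_succ, this,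
      show 2 * (i + 1) + d = 2 * i + (d + 1) + 1 by ring, Nat.factorial_succ (2 * i + _),
      Nat.factorial_succ d]
    have : (d.factorial : ℝ) ≠ 0 := by positivity
    push_cast
    field_simp
    ring

/-- The weight of the degree `l` in the sums over Legendre functions of degree `l < p`. -/
noncomputable def degreeWeight (p l : ℕ) : ℝ :=
  (-1) ^ l * (2 * l + 1) / (((p : ℝ) - l) * (p + l + 1))

/-- The sum telescopes, since
`(2 * l + 1) * legendreCoeff l m` is the sum of `(l - m) * legendreCoeff l m` and
`(l + 1 - m) * legendreCoeff (l + 1) m`. -/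
theorem sum_legendreCoeff (p m : ℕ) :
    ∑ l ∈ range p, (-1) ^ l * (2 * l + 1) * legendreCoeff l m =
      (-1) ^ (p + 1) * (((p : ℝ) - m) * legendreCoeff p m) := by
  induction p with
  | zero =>
    cases m with
    | zero => simp
    | succ m => simp [legendreCoeff_of_lt]
  | succ p ih =>
    have key : ((p : ℝ) + 1 - m) * legendreCoeff (p + 1) m = (p + 1 + m) * legendreCoeff p m := by
      rcases lt_or_ge p m with h | h
      · rw [legendreCoeff_of_lt h]
        rcases Nat.lt_or_ge (p + 1) m with h' | h'
        · rw [legendreCoeff_of_lt h']; ring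
        · rw [show m = p + 1 by omega]; push_cast; ring
      · obtain ⟨d, rfl⟩ := Nat.exists_eq_add_of_le h
        rw [legendreCoeff_eq, add_assoc, legendreCoeff_eq, ← add_assoc, Nat.factorial_succ d,
          Nat.factorial_succ]
        have : (d.factorial : ℝ) ≠ 0 := by positivity
        push_cast
        field_simp
        ring
    rw [sum_range_succ, ih]
    push_cast
    rw [key]
    ring

/-- By downward induction on `m`: both sides satisfy the same two-term recurrence, because
`(l - m) (l + m + 1) = (p - m) (p + m + 1) - (p - l) (p + l + 1)` and the last product cancels the
denominator of `degreeWeight p l`. -/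
theorem legendreCoeff_mul_harmonic (p m : ℕ) (h : m ≤ p) :
    legendreCoeff p m * ((harmonic (2 * p) : ℝ) - harmonic (p + m)) =
      (-1) ^ (p + 1) * ∑ l ∈ range p, degreeWeight p l * legendreCoeff l m := by
  induction h using Nat.decreasingInduction with
  | self =>
    rw [sum_eq_zero, two_mul]
    · ring
    · intro l hl
      rw [legendreCoeff_of_lt (mem_range.1 hl), mul_zero]
  | of_succ m hm ih =>
    have hm' : (p : ℝ) - m ≠ 0 := by
      have : (m : ℝ) < p := by exact_mod_cast hm
      linarith
    have hm2 : (p : ℝ) + 1 + m ≠ 0 := by positivity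
    have e : ∑ l ∈ range p, degreeWeight p l * legendreCoeff l (m + 1) =
        ((p : ℝ) - m) * (p + 1 + m) * ∑ l ∈ range p, degreeWeight p l * legendreCoeff l m -
        ∑ l ∈ range p, (-1) ^ l * (2 * l + 1) * legendreCoeff l m := by
      rw [mul_sum, ← sum_sub_distrib]
      refine sum_congr rfl fun l hl => ?_
      have : (p : ℝ) - l ≠ 0 := by
        have : (l : ℝ) < p := by exact_mod_cast mem_range.1 hl
        linarith
      have : (p : ℝ) + l + 1 ≠ 0 := by positivity
      rw [legendreCoeff_succ, degreeWeight]
      field_simp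
      ring
    rw [e, sum_legendreCoeff, legendreCoeff_succ, ← add_assoc, harmonic_succ] at ih
    push_cast at ih
    apply mul_left_cancel₀ (mul_ne_zero hm' hm2)
    have h3 : ((-1 : ℝ) ^ (p + 1)) * (-1) ^ (p + 1) = 1 := by
      rw [← mul_pow]; simp
    have h4 : (p : ℝ) + m + 1 ≠ 0 := by positivity
    have h5 : ((p : ℝ) + m + 1)⁻¹ * (p + 1 + m) = 1 := by field_simp; ring
    linear_combination ih + ((p : ℝ) - m) * legendreCoeff p m * (h5 - h3)

/-! ### Legendre functions at `coth η` -/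

theorem realDigamma_natCast_add_one (n : ℕ) :
    realDigamma ((n : ℝ) + 1) = harmonic n - Real.eulerMascheroniConstant := by
  have h : Complex.digamma ((n : ℂ) + 1) =
      (harmonic n : ℂ) - Real.eulerMascheroniConstant := by
    induction n with
    | zero => simp [Complex.digamma_one]
    | succ n ih =>
      rw [Nat.cast_succ, Complex.digamma_apply_add_one, ih, harmonic_succ]
      · push_cast; ring
      · intro m hm
        have : (((n + 1 + m : ℕ) : ℂ)) = 0 := by push_cast; rw [hm]; ring
        exact absurd (Nat.cast_eq_zero.1 this) (by omega)
  rw [realDigamma]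
  push_cast
  rw [h]
  simp

theorem sinh_eq_exp_neg (η : ℝ) :
    Real.sinh η = (1 - Real.exp (-η) ^ 2) / (2 * Real.exp (-η)) := by
  have := Real.exp_ne_zero η
  rw [Real.sinh_eq, Real.exp_neg]
  field_simp

theorem cosh_eq_exp_neg (η : ℝ) :
    Real.cosh η = (1 + Real.exp (-η) ^ 2) / (2 * Real.exp (-η)) := by
  have := Real.exp_ne_zero η
  rw [Real.cosh_eq, Real.exp_neg]
  field_simp

theorem exp_neg_sq_lt_one {η : ℝ} (hη : 0 < η) : Real.exp (-η) ^ 2 < 1 :=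
  pow_lt_one₀ (Real.exp_pos _).le (Real.exp_lt_one_iff.2 (by linarith)) two_ne_zero

/-- The defining series of `P_l^μ` at `coth η`, homogenized to degree `p ≥ l` by the factor
`(1 - x) ^ p`, where `x = exp (-η) ^ 2`; its argument is `(1 - coth η) / 2 = -x / (1 - x)`. -/
theorem assocLegendreP_hypCoth {η : ℝ} (hη : 0 < η) {l p : ℕ} (hl : l ≤ p) (μ : ℤ) :
    (1 - Real.exp (-η) ^ 2) ^ p * assocLegendreP l μ (hypCoth η) =
      Real.exp (-η) ^ (-μ) * ∑ i ∈ range (p + 1),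
        legendreCoeff l i / (i.factorial * Real.Gamma (1 - (μ : ℝ) + i)) *
          ((Real.exp (-η) ^ 2) ^ i * (1 - Real.exp (-η) ^ 2) ^ (p - i)) := by
  have hs : (1 - Real.exp (-η) ^ 2) ≠ 0 := by linarith [exp_neg_sq_lt_one hη]
  have hq := Real.exp_pos (-η)
  have hz : (1 - hypCoth η) / 2 = - (Real.exp (-η) ^ 2 / (1 - Real.exp (-η) ^ 2)) := by
    rw [hypCoth, sinh_eq_exp_neg, cosh_eq_exp_neg]
    field_simp
    ring
  have hz2 : ((hypCoth η + 1) / (hypCoth η - 1)) ^ ((μ : ℝ) / 2) = Real.exp (-η) ^ (-μ) := by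
    have : (hypCoth η + 1) / (hypCoth η - 1) = Real.exp (2 * η) := by
      have e : Real.exp (2 * η) = (Real.exp (-η) ^ 2)⁻¹ := by
        rw [← Real.exp_nat_mul, ← Real.exp_neg]; congr 1; push_cast; ring
      have e1 : hypCoth η - 1 = 2 * (Real.exp (-η) ^ 2 / (1 - Real.exp (-η) ^ 2)) := by linarith
      have e2 : hypCoth η + 1 = 2 * (1 / (1 - Real.exp (-η) ^ 2)) := by
        have : 1 / (1 - Real.exp (-η) ^ 2) = Real.exp (-η) ^ 2 / (1 - Real.exp (-η) ^ 2) + 1 := by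
          field_simp
          ring
        linarith
      rw [e1, e2, e]
      field_simp
    rw [this, ← Real.exp_mul, ← Real.rpow_intCast, ← Real.exp_mul]
    congr 1
    push_cast
    ring
  rw [assocLegendreP, hz2, hz, regHypergeometric, tsum_eq_sum (s := range (p + 1))]
  · rw [mul_left_comm, mul_sum]
    congr 1
    refine sum_congr rfl fun i hi => ?_
    obtain ⟨d, rfl⟩ := Nat.exists_eq_add_of_le (mem_range_succ_iff.1 hi)
    rw [Nat.add_sub_cancel_left, legendreCoeff, neg_pow, div_pow, pow_add]
    field_simp
  · intro k hk
    rw [ascPochhammer_eval_neg_coe_nat_of_lt (lt_of_le_of_lt hl (by simpa using hk))]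
    simp

theorem assocLegendreP_neg_hypCoth {η : ℝ} (hη : 0 < η) {l p : ℕ} (hl : l ≤ p) (n : ℕ) :
    (1 - Real.exp (-η) ^ 2) ^ p * assocLegendreP l (-(n : ℤ)) (hypCoth η) =
      Real.exp (-η) ^ n * ∑ i ∈ range (p + 1),
        legendreCoeff l i / (i.factorial * (n + i).factorial) *
          ((Real.exp (-η) ^ 2) ^ i * (1 - Real.exp (-η) ^ 2) ^ (p - i)) := by
  rw [assocLegendreP_hypCoth hη hl, neg_neg, zpow_natCast]
  congr 1
  refine sum_congr rfl fun i _ => ?_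
  rw [show (1 - ((-(n : ℤ) : ℤ) : ℝ) + i) = ((n + i : ℕ) : ℝ) + 1 by push_cast; ring,
    Real.Gamma_nat_eq_factorial]

/-- For positive order `n` the terms of index `< n` vanish with `1 / Γ`, and the remaining ones are
shifted by `n`. -/
theorem assocLegendreP_natCast_hypCoth {η : ℝ} (hη : 0 < η) {l n m : ℕ} (hl : l ≤ n + m) :
    (1 - Real.exp (-η) ^ 2) ^ (n + m) * assocLegendreP l n (hypCoth η) =
      Real.exp (-η) ^ n * ∑ i ∈ range (m + 1),
        legendreCoeff l (n + i) / ((n + i).factorial * i.factorial) *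
          ((Real.exp (-η) ^ 2) ^ i * (1 - Real.exp (-η) ^ 2) ^ (m - i)) := by
  have hq := Real.exp_ne_zero (-η)
  rw [assocLegendreP_hypCoth hη hl, add_assoc, sum_range_add, sum_eq_zero (s := range n), zero_add,
    mul_sum, mul_sum]
  · refine sum_congr rfl fun i _ => ?_
    rw [show (1 - ((n : ℤ) : ℝ) + (n + i : ℕ)) = (i : ℝ) + 1 by push_cast; ring,
      Real.Gamma_nat_eq_factorial, Nat.add_sub_add_left, zpow_neg, zpow_natCast]
    field_simp
    ring
  · intro i hi
    obtain ⟨d, hd⟩ := Nat.exists_eq_add_of_lt (mem_range.1 hi)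
    rw [show (1 - ((n : ℤ) : ℝ) + i) = -(d : ℝ) by rw [hd]; push_cast; ring,
      Real.Gamma_neg_nat_eq_zero]
    simp

/-- Up to sign, the left side is the coefficient of `exp (i n ψ)` in `|1 + w| ^ (2 p)`. -/
theorem sum_choose_mul_choose_eq_neg {η : ℝ} (hη : 0 < η) {n p : ℕ} (hn : n ≤ p) :
    Real.exp (-η) ^ n * ∑ j ∈ range (p + 1),
        (p.choose j : ℝ) * (p.choose (n + j) * (Real.exp (-η) ^ 2) ^ j) =
      (1 - Real.exp (-η) ^ 2) ^ p * (p.factorial / (p - n).factorial *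
        assocLegendreP p (-(n : ℤ)) (hypCoth η)) := by
  have h := isPascal_choose.sum_choose_mul (Real.exp (-η) ^ 2) (1 - Real.exp (-η) ^ 2) p p n
  simp only [add_sub_cancel, one_pow, mul_one] at h
  rw [h, mul_left_comm, assocLegendreP_neg_hypCoth hη le_rfl, mul_left_comm, mul_sum _ _ (_ / _)]
  congr 1
  refine sum_congr rfl fun i hi => ?_
  obtain ⟨d, rfl⟩ := Nat.exists_eq_add_of_le (mem_range_succ_iff.1 hi)
  rw [legendreCoeff_eq, Nat.cast_choose ℝ (by omega), Nat.cast_choose ℝ (by omega),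
    show i + d - i = d by omega, show i + d + i - (n + i) = i + d - n by omega,
    show 2 * i + d = i + d + i by ring]
  have : ((i + d).factorial : ℝ) ≠ 0 := by positivity
  field_simp

/-- The coefficient of `sum_choose_mul_choose_eq_neg`, in terms of the order `n` in place
of `-n`. -/
theorem sum_choose_mul_choose_eq_pos {η : ℝ} (hη : 0 < η) {n p : ℕ} (hn : n ≤ p) :
    Real.exp (-η) ^ n * ∑ j ∈ range (p + 1),
        (p.choose j : ℝ) * (p.choose (n + j) * (Real.exp (-η) ^ 2) ^ j) =
      (1 - Real.exp (-η) ^ 2) ^ p * (p.factorial / (p + n).factorial *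
        assocLegendreP p n (hypCoth η)) := by
  obtain ⟨m, rfl⟩ := Nat.exists_eq_add_of_le hn
  have h := isPascal_choose.sum_choose_add_mul (Real.exp (-η) ^ 2) (1 - Real.exp (-η) ^ 2) m
    (n + m) n
  simp only [add_sub_cancel, one_pow, mul_one] at h
  have h0 : ∑ j ∈ range (n + m + 1), ((n + m).choose j : ℝ) *
      ((n + m).choose (n + j) * (Real.exp (-η) ^ 2) ^ j) =
      ∑ j ∈ range (m + 1), ((n + m).choose (n + j) : ℝ) *
      ((n + m).choose j * (Real.exp (-η) ^ 2) ^ j) := by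
    rw [show n + m + 1 = (m + 1) + n by ring, sum_range_add, add_eq_left.2]
    · exact sum_congr rfl fun _ _ => by ring
    · refine sum_eq_zero fun i _ => ?_
      rw [Nat.choose_eq_zero_of_lt (show n + m < n + (m + 1 + i) by omega)]
      simp
  rw [h0, h, mul_left_comm, assocLegendreP_natCast_hypCoth hη le_rfl, mul_left_comm,
    mul_sum _ _ (_ / _)]
  congr 1
  refine sum_congr rfl fun i hi => ?_
  obtain ⟨d, rfl⟩ := Nat.exists_eq_add_of_le (mem_range_succ_iff.1 hi)
  rw [← add_assoc n i d, legendreCoeff_eq, Nat.cast_choose ℝ (by omega),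
    Nat.cast_choose ℝ (by omega),
    show n + i + d - (n + i) = d by omega, show n + i + d + (n + i) - i = n + i + d + n by omega,
    show 2 * (n + i) + d = n + i + d + (n + i) by ring]
  have : ((n + i + d).factorial : ℝ) ≠ 0 := by positivity
  field_simp

theorem assocLegendreP_natCast_eq_neg {η : ℝ} (hη : 0 < η) {n l : ℕ} (hn : n ≤ l) :
    assocLegendreP l n (hypCoth η) =
      (l + n).factorial / (l - n).factorial * assocLegendreP l (-(n : ℤ)) (hypCoth η) := by
  have hs : (1 - Real.exp (-η) ^ 2) ≠ 0 := by linarith [exp_neg_sq_lt_one hη]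
  have h := (sum_choose_mul_choose_eq_neg hη hn).symm.trans (sum_choose_mul_choose_eq_pos hη hn)
  have h := mul_left_cancel₀ (pow_ne_zero _ hs) h
  have : (l.factorial : ℝ) ≠ 0 := by positivity
  have : ((l + n).factorial : ℝ) ≠ 0 := by positivity
  field_simp at h ⊢
  linarith

/-- `legendreCoeff_mul_harmonic` applied to each coefficient of a family `F` that has the shape of
the Legendre functions of fixed order. -/
theorem sum_degreeWeight_mul {p : ℕ} {S : Finset ℕ} {g : ℕ → ℕ} (hg : ∀ i ∈ S, g i ≤ p)
    {K F : ℕ → ℝ} (hF : ∀ l ≤ p, F l = ∑ i ∈ S, legendreCoeff l (g i) * K i) (c : ℝ) :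
    ((harmonic (2 * p) : ℝ) - c) * F p + (-1) ^ p * ∑ l ∈ range p, degreeWeight p l * F l =
      ∑ i ∈ S, legendreCoeff p (g i) * ((harmonic (p + g i) : ℝ) - c) * K i := by
  have h : ∑ l ∈ range p, degreeWeight p l * F l =
      ∑ i ∈ S, (∑ l ∈ range p, degreeWeight p l * legendreCoeff l (g i)) * K i := by
    simp only [sum_mul]
    rw [sum_comm]
    refine sum_congr rfl fun l hl => ?_
    rw [hF l (mem_range.1 hl).le, mul_sum]
    exact sum_congr rfl fun _ _ => by ring
  rw [h, hF p le_rfl, mul_sum, mul_sum, ← sum_add_distrib]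
  refine sum_congr rfl fun i hi => ?_
  have h4 : (-1 : ℝ) ^ (p + 1) = -(-1) ^ p := by ring
  have key := legendreCoeff_mul_harmonic p (g i) (hg i hi)
  rw [h4] at key
  linear_combination K i * key

/-- The part of the `n`-th Fourier coefficient, `n ≤ p`, in which the logarithmic series carries the
higher power. -/
theorem sum_choose_mul_logBinom {η : ℝ} (hη : 0 < η) {n p : ℕ} (hn : n ≤ p) :
    Real.exp (-η) ^ n * ∑ j ∈ range (p + 1),
        (p.choose j : ℝ) * (logBinom p (n + j) * (Real.exp (-η) ^ 2) ^ j) =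
      (1 - Real.exp (-η) ^ 2) ^ p * (p.factorial / (p - n).factorial *
        (((harmonic (2 * p) : ℝ) - harmonic (p - n)) * assocLegendreP p (-(n : ℤ)) (hypCoth η) +
          (-1) ^ p * ∑ l ∈ range p,
            degreeWeight p l * assocLegendreP l (-(n : ℤ)) (hypCoth η))) := by
  have h := isPascal_logBinom.sum_choose_mul (Real.exp (-η) ^ 2) (1 - Real.exp (-η) ^ 2) p p n
  simp only [add_sub_cancel, one_pow, mul_one] at h
  have h1 := sum_degreeWeight_mul (p := p) (S := range (p + 1)) (g := fun i => i)
    (K := fun i => Real.exp (-η) ^ n / (i.factorial * (n + i).factorial) *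
      ((Real.exp (-η) ^ 2) ^ i * (1 - Real.exp (-η) ^ 2) ^ (p - i)))
    (F := fun l => (1 - Real.exp (-η) ^ 2) ^ p * assocLegendreP l (-(n : ℤ)) (hypCoth η))
    (fun i hi => mem_range_succ_iff.1 hi)
    (fun l hl => by
      rw [assocLegendreP_neg_hypCoth hη hl, mul_sum]
      exact sum_congr rfl fun _ _ => by ring) (harmonic (p - n))
  have h2 : ∑ l ∈ range p, degreeWeight p l *
      ((1 - Real.exp (-η) ^ 2) ^ p * assocLegendreP l (-(n : ℤ)) (hypCoth η)) =
      (1 - Real.exp (-η) ^ 2) ^ p * ∑ l ∈ range p, degreeWeight p l *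
        assocLegendreP l (-(n : ℤ)) (hypCoth η) := by
    rw [mul_sum]
    exact sum_congr rfl fun _ _ => by ring
  rw [h2] at h1
  trans p.factorial / (p - n).factorial * ∑ i ∈ range (p + 1), legendreCoeff p i *
    ((harmonic (p + i) : ℝ) - harmonic (p - n)) *
      (Real.exp (-η) ^ n / (i.factorial * (n + i).factorial) *
      ((Real.exp (-η) ^ 2) ^ i * (1 - Real.exp (-η) ^ 2) ^ (p - i)))
  · rw [h, mul_sum, mul_sum]
    refine sum_congr rfl fun i hi => ?_
    obtain ⟨d, rfl⟩ := Nat.exists_eq_add_of_le (mem_range_succ_iff.1 hi)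
    rw [logBinom_of_le _ _ (by omega), legendreCoeff_eq, Nat.cast_choose ℝ (by omega),
      Nat.cast_choose ℝ (by omega),
      show i + d - i = d by omega, show i + d + i - (n + i) = i + d - n by omega,
      show 2 * i + d = i + d + i by ring]
    have : ((i + d).factorial : ℝ) ≠ 0 := by positivity
    field_simp
  · rw [← h1]
    ring

/-- The part of the `n`-th Fourier coefficient, `n ≤ p`, in which the logarithmic series carries the
lower power. -/
theorem sum_choose_add_mul_logBinom {η : ℝ} (hη : 0 < η) {n p : ℕ} (hn : n ≤ p) :
    Real.exp (-η) ^ n * ∑ j ∈ range (p + 1),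
        (p.choose (n + j) : ℝ) * (logBinom p j * (Real.exp (-η) ^ 2) ^ j) =
      (1 - Real.exp (-η) ^ 2) ^ p * (p.factorial / (p + n).factorial *
        (((harmonic (2 * p) : ℝ) - harmonic (p + n)) * assocLegendreP p n (hypCoth η) +
          (-1) ^ p * ∑ l ∈ range p, degreeWeight p l * assocLegendreP l n (hypCoth η))) := by
  obtain ⟨m, rfl⟩ := Nat.exists_eq_add_of_le hn
  have h := isPascal_logBinom.sum_choose_add_mul (Real.exp (-η) ^ 2) (1 - Real.exp (-η) ^ 2) m
    (n + m) n
  simp only [add_sub_cancel, one_pow, mul_one] at h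
  have h0 : ∑ j ∈ range (n + m + 1), ((n + m).choose (n + j) : ℝ) *
      (logBinom (n + m) j * (Real.exp (-η) ^ 2) ^ j) =
      ∑ j ∈ range (m + 1), ((n + m).choose (n + j) : ℝ) *
      (logBinom (n + m) j * (Real.exp (-η) ^ 2) ^ j) := by
    rw [show n + m + 1 = (m + 1) + n by ring, sum_range_add, add_eq_left.2]
    refine sum_eq_zero fun i _ => ?_
    rw [Nat.choose_eq_zero_of_lt (show n + m < n + (m + 1 + i) by omega)]
    simp
  have h1 := sum_degreeWeight_mul (p := n + m) (S := range (m + 1)) (g := fun i => n + i)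
    (K := fun i => Real.exp (-η) ^ n / ((n + i).factorial * i.factorial) *
      ((Real.exp (-η) ^ 2) ^ i * (1 - Real.exp (-η) ^ 2) ^ (m - i)))
    (F := fun l => (1 - Real.exp (-η) ^ 2) ^ (n + m) * assocLegendreP l n (hypCoth η))
    (fun i hi => by have := mem_range_succ_iff.1 hi; omega)
    (fun l hl => by
      rw [assocLegendreP_natCast_hypCoth hη hl, mul_sum]
      exact sum_congr rfl fun _ _ => by ring) (harmonic (n + m + n))
  have h2 : ∑ l ∈ range (n + m), degreeWeight (n + m) l *
      ((1 - Real.exp (-η) ^ 2) ^ (n + m) * assocLegendreP l n (hypCoth η)) =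
      (1 - Real.exp (-η) ^ 2) ^ (n + m) * ∑ l ∈ range (n + m), degreeWeight (n + m) l *
        assocLegendreP l n (hypCoth η) := by
    rw [mul_sum]
    exact sum_congr rfl fun _ _ => by ring
  rw [h2] at h1
  trans (n + m).factorial / (n + m + n).factorial * ∑ i ∈ range (m + 1),
    legendreCoeff (n + m) (n + i) * ((harmonic (n + m + (n + i)) : ℝ) - harmonic (n + m + n)) *
      (Real.exp (-η) ^ n / ((n + i).factorial * i.factorial) *
      ((Real.exp (-η) ^ 2) ^ i * (1 - Real.exp (-η) ^ 2) ^ (m - i)))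
  · rw [h0, h, mul_sum, mul_sum]
    refine sum_congr rfl fun i hi => ?_
    obtain ⟨d, rfl⟩ := Nat.exists_eq_add_of_le (mem_range_succ_iff.1 hi)
    rw [logBinom_of_le _ _ (by omega), ← add_assoc n i d, legendreCoeff_eq,
      Nat.cast_choose ℝ (by omega), Nat.cast_choose ℝ (by omega),
      show n + i + d - (n + i) = d by omega, show n + i + d + (n + i) - i = n + i + d + n by omega,
      show 2 * (n + i) + d = n + i + d + (n + i) by ring]
    have : ((n + i + d).factorial : ℝ) ≠ 0 := by positivity
    field_simp
  · rw [← h1]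
    ring

theorem assocLegendreP_natCast_of_lt {η : ℝ} (hη : 0 < η) {l n : ℕ} (h : l < n) :
    assocLegendreP l n (hypCoth η) = 0 := by
  have hs : (1 - Real.exp (-η) ^ 2) ≠ 0 := by linarith [exp_neg_sq_lt_one hη]
  have h1 := assocLegendreP_natCast_hypCoth hη (l := l) (n := n) (m := 0) h.le
  simpa [hs, legendreCoeff_of_lt h] using h1

/-- Beyond the degree, `n = p + 1 + m`, the numbers `logBinom p (n + j)` are products of factorials
and a single Legendre function results. -/
theorem sum_choose_mul_logBinom_of_lt {η : ℝ} (hη : 0 < η) (p m : ℕ) :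
    Real.exp (-η) ^ (p + 1 + m) * ∑ j ∈ range (p + 1),
        (p.choose j : ℝ) * (logBinom p (p + 1 + m + j) * (Real.exp (-η) ^ 2) ^ j) =
      (1 - Real.exp (-η) ^ 2) ^ p * ((-1) ^ m * (p.factorial * m.factorial) *
        assocLegendreP p (-((p + 1 + m : ℕ) : ℤ)) (hypCoth η)) := by
  have h := isPascal_logBinom.sum_choose_mul (Real.exp (-η) ^ 2) (1 - Real.exp (-η) ^ 2) p p
    (p + 1 + m)
  simp only [add_sub_cancel, one_pow, mul_one] at h
  rw [h, mul_left_comm, assocLegendreP_neg_hypCoth hη le_rfl, mul_left_comm, mul_sum _ _ (_ * _)]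
  congr 1
  refine sum_congr rfl fun i hi => ?_
  obtain ⟨d, rfl⟩ := Nat.exists_eq_add_of_le (mem_range_succ_iff.1 hi)
  rw [legendreCoeff_eq, Nat.cast_choose ℝ (by omega),
    show i + d + 1 + m + i = i + d + i + 1 + m by ring, logBinom_of_lt,
    show i + d - i = d by omega, show 2 * i + d = i + d + i by ring]
  field_simp

/-! ### Regrouping a product of power series into a cosine series -/

theorem hasSum_logBinom (p : ℕ) {w : ℂ} (hw : ‖w‖ < 1) :
    HasSum (fun a => (logBinom p a : ℂ) * w ^ a) ((1 + w) ^ p * Complex.log (1 + w)) := by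
  induction p with
  | zero =>
    rw [pow_zero, one_mul]
    refine (Complex.hasSum_taylorSeries_log hw).congr_fun fun a => ?_
    simp only [logBinom]
    push_cast
    ring
  | succ p ih =>
    have h1 := (hasSum_nat_add_iff' 1).2 ih
    have h2 := (ih.mul_left w).add h1
    rw [← hasSum_nat_add_iff' 1]
    have hS : (1 + w) ^ (p + 1) * Complex.log (1 + w) -
        ∑ i ∈ range 1, (logBinom (p + 1) i : ℂ) * w ^ i =
        w * ((1 + w) ^ p * Complex.log (1 + w)) + ((1 + w) ^ p * Complex.log (1 + w) -
          ∑ i ∈ range 1, (logBinom p i : ℂ) * w ^ i) := by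
      simp only [range_one, sum_singleton, logBinom_zero_right]
      push_cast
      ring
    rw [hS]
    refine h2.congr_fun fun a => ?_
    rw [isPascal_logBinom.succ]
    push_cast
    ring

theorem hasSum_choose (p : ℕ) (w : ℂ) :
    HasSum (fun a => ((p.choose a : ℝ) : ℂ) * w ^ a) ((1 + w) ^ p) := by
  have h : (1 + w) ^ p = ∑ a ∈ range (p + 1), ((p.choose a : ℝ) : ℂ) * w ^ a := by
    rw [add_comm, add_pow]
    exact sum_congr rfl fun _ _ => by simp [mul_comm]
  rw [h]
  refine hasSum_sum_of_ne_finset_zero fun b hb => ?_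
  rw [Nat.choose_eq_zero_of_lt (by simpa using hb)]
  simp

theorem re_mul_pow_mul_conj_pow (r ψ : ℝ) (a b : ℕ) :
    ((r * Complex.exp (ψ * Complex.I)) ^ a *
      (starRingEnd ℂ (r * Complex.exp (ψ * Complex.I))) ^ b).re =
      r ^ (a + b) * Real.cos (((a : ℝ) - b) * ψ) := by
  have h : (r * Complex.exp (ψ * Complex.I)) ^ a *
      (starRingEnd ℂ (r * Complex.exp (ψ * Complex.I))) ^ b =
      ((r ^ (a + b) : ℝ) : ℂ) * Complex.exp (((((a : ℝ) - b) * ψ : ℝ) : ℂ) * Complex.I) := by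
    rw [map_mul, ← Complex.exp_conj, map_mul, Complex.conj_I, Complex.conj_ofReal,
      Complex.conj_ofReal, mul_pow, mul_pow, ← Complex.exp_nat_mul, ← Complex.exp_nat_mul,
      mul_mul_mul_comm, ← Complex.exp_add, ← pow_add]
    push_cast
    congr 2
    ring
  rw [h, Complex.re_ofReal_mul, Complex.exp_ofReal_mul_I_re]

/-- Collecting the terms of a double sum by `n = |a - b|`; the two inner sums on the right belong to
`a = b + n` and `b = a + n`. They agree for `n = 0`, which is then counted once. -/
theorem sum_range_range_add (p : ℕ) (d : ℕ → ℝ) (r ψ : ℝ) :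
    ∑ b ∈ range (p + 1), ∑ a ∈ range (b + (p + 1)),
      (p.choose b : ℝ) * d a * (r ^ (a + b) * Real.cos (((a : ℝ) - b) * ψ)) =
    ∑ n ∈ range (p + 1), neumannFactor n / 2 * Real.cos (n * ψ) * (r ^ n *
      (∑ j ∈ range (p + 1), (p.choose j : ℝ) * (d (n + j) * (r ^ 2) ^ j) +
        ∑ j ∈ range (p + 1), (p.choose (n + j) : ℝ) * (d j * (r ^ 2) ^ j))) := by
  rw [sum_congr rfl fun b _ => sum_range_add (fun a => (p.choose b : ℝ) * d a *
    (r ^ (a + b) * Real.cos (((a : ℝ) - b) * ψ))) b (p + 1), sum_add_distrib]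
  have e2 : ∑ b ∈ range (p + 1), ∑ k ∈ range (p + 1), (p.choose b : ℝ) * d (b + k) *
      (r ^ (b + k + b) * Real.cos ((((b + k : ℕ) : ℝ) - b) * ψ)) =
      ∑ n ∈ range (p + 1), Real.cos (n * ψ) * (r ^ n *
        ∑ j ∈ range (p + 1), (p.choose j : ℝ) * (d (n + j) * (r ^ 2) ^ j)) := by
    rw [sum_comm]
    refine sum_congr rfl fun n _ => ?_
    rw [mul_sum, mul_sum]
    refine sum_congr rfl fun j _ => ?_
    rw [show (((j + n : ℕ) : ℝ) - j) = n by push_cast; ring, add_comm j n]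
    ring
  have e1 : ∑ b ∈ range (p + 1), ∑ a ∈ range b, (p.choose b : ℝ) * d a *
      (r ^ (a + b) * Real.cos (((a : ℝ) - b) * ψ)) =
      ∑ n ∈ range p, Real.cos ((n + 1 : ℕ) * ψ) * (r ^ (n + 1) *
        ∑ j ∈ range (p + 1), (p.choose (n + 1 + j) : ℝ) * (d j * (r ^ 2) ^ j)) := by
    have := sum_range_diag_flip p (fun j k => (p.choose (j + k + 1) : ℝ) * d j *
      (r ^ (j + (j + k + 1)) * Real.cos (((j : ℝ) - (j + k + 1 : ℕ)) * ψ)))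
    rw [sum_range_succ', sum_range_zero, add_zero]
    trans ∑ m ∈ range p, ∑ k ∈ range (m + 1), (p.choose (k + (m - k) + 1) : ℝ) * d k *
      (r ^ (k + (k + (m - k) + 1)) * Real.cos (((k : ℝ) - (k + (m - k) + 1 : ℕ)) * ψ))
    · refine sum_congr rfl fun m _ => sum_congr rfl fun k hk => ?_
      rw [Nat.add_sub_cancel' (mem_range_succ_iff.1 hk)]
    rw [this]
    trans ∑ j ∈ range (p + 1), ∑ k ∈ range p, (p.choose (j + k + 1) : ℝ) * d j *
      (r ^ (j + (j + k + 1)) * Real.cos (((j : ℝ) - (j + k + 1 : ℕ)) * ψ))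
    · have hz : ∀ j k, p - j ≤ k → (p.choose (j + k + 1) : ℝ) = 0 := fun j k h => by
        rw [Nat.choose_eq_zero_of_lt (by omega), Nat.cast_zero]
      rw [sum_range_succ, sum_eq_zero (s := range p)
        (f := fun k => (p.choose (p + k + 1) : ℝ) * d p *
        (r ^ (p + (p + k + 1)) * Real.cos (((p : ℝ) - (p + k + 1 : ℕ)) * ψ))), add_zero]
      · refine sum_congr rfl fun j _ => sum_subset (range_mono (Nat.sub_le _ _)) fun k _ hk => ?_
        rw [hz j k (by simpa using hk)]
        ring
      · intro k _
        rw [hz p k (by omega)]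
        ring
    · rw [sum_comm]
      refine sum_congr rfl fun n _ => ?_
      rw [mul_sum, mul_sum]
      refine sum_congr rfl fun j _ => ?_
      rw [show ((j : ℝ) - (j + n + 1 : ℕ)) * ψ = -((n + 1 : ℕ) * ψ) by push_cast; ring,
        Real.cos_neg, show j + n + 1 = n + 1 + j by ring]
      ring
  have key : ∀ U V : ℕ → ℝ, U 0 = V 0 →
      ∑ n ∈ range p, Real.cos ((n + 1 : ℕ) * ψ) * (r ^ (n + 1) * V (n + 1)) +
        ∑ n ∈ range (p + 1), Real.cos (n * ψ) * (r ^ n * U n) =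
      ∑ n ∈ range (p + 1), neumannFactor n / 2 * Real.cos (n * ψ) * (r ^ n * (U n + V n)) := by
    intro U V h0
    rw [sum_range_succ' _ p, sum_range_succ' _ p, ← add_assoc, ← sum_add_distrib]
    congr 1
    · refine sum_congr rfl fun n _ => ?_
      rw [neumannFactor, if_neg n.succ_ne_zero]
      ring
    · rw [neumannFactor, if_pos rfl, h0]
      ring
  rw [e1, e2]
  exact key (fun n => ∑ j ∈ range (p + 1), (p.choose j : ℝ) * (d (n + j) * (r ^ 2) ^ j))
    (fun n => ∑ j ∈ range (p + 1), (p.choose (n + j) : ℝ) * (d j * (r ^ 2) ^ j)) (by simp)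

/-- The cosine series of the real part of `A * (1 + conj w) ^ p`, where `A = ∑ d a * w ^ a` and
`w = r * exp (i ψ)`. The frequencies `n ≤ p`, to which both `a ≥ b` and `a ≤ b` contribute, stand on
the right; those with `n > p` form the series. -/
theorem hasSum_cos_of_hasSum (p : ℕ) {d : ℕ → ℝ} {r ψ : ℝ} {A : ℂ}
    (hA : HasSum (fun a => (d a : ℂ) * (r * Complex.exp (ψ * Complex.I)) ^ a) A) :
    HasSum (fun m : ℕ => Real.cos ((p + 1 + m : ℕ) * ψ) * (r ^ (p + 1 + m) *
        ∑ j ∈ range (p + 1), (p.choose j : ℝ) * (d (p + 1 + m + j) * (r ^ 2) ^ j)))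
      ((A * (1 + starRingEnd ℂ (r * Complex.exp (ψ * Complex.I))) ^ p).re -
        ∑ n ∈ range (p + 1), neumannFactor n / 2 * Real.cos (n * ψ) * (r ^ n *
      (∑ j ∈ range (p + 1), (p.choose j : ℝ) * (d (n + j) * (r ^ 2) ^ j) +
        ∑ j ∈ range (p + 1), (p.choose (n + j) : ℝ) * (d j * (r ^ 2) ^ j)))) := by
  have h1 : ∀ b ∈ range (p + 1), HasSum (fun m : ℕ => (p.choose b : ℝ) *
      d (m + (b + (p + 1))) * (r ^ (m + (b + (p + 1)) + b) *
        Real.cos (((m + (b + (p + 1)) : ℕ) - b : ℝ) * ψ)))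
      ((A * ((p.choose b : ℝ) * (starRingEnd ℂ (r * Complex.exp (ψ * Complex.I))) ^ b)).re -
        ∑ a ∈ range (b + (p + 1)),
      (p.choose b : ℝ) * d a * (r ^ (a + b) * Real.cos (((a : ℝ) - b) * ψ))) := by
    intro b _
    refine (hasSum_nat_add_iff' (f := fun a : ℕ => (p.choose b : ℝ) * d a *
      (r ^ (a + b) * Real.cos (((a : ℝ) - b) * ψ))) (b + (p + 1))).2 ?_
    refine (Complex.hasSum_re (hA.mul_right ((p.choose b : ℝ) *
      (starRingEnd ℂ (r * Complex.exp (ψ * Complex.I))) ^ b))).congr_fun fun a => ?_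
    rw [← re_mul_pow_mul_conj_pow, mul_mul_mul_comm, ← Complex.ofReal_mul, Complex.re_ofReal_mul,
      mul_comm (d a)]
  have h2 := hasSum_sum h1
  rw [sum_sub_distrib, sum_range_range_add] at h2
  rw [← Complex.re_sum, ← mul_sum] at h2
  have hp : (1 + starRingEnd ℂ (r * Complex.exp (ψ * Complex.I))) ^ p =
      ∑ b ∈ range (p + 1), ((p.choose b : ℝ) : ℂ) *
        (starRingEnd ℂ (r * Complex.exp (ψ * Complex.I))) ^ b := by
    rw [add_comm, add_pow]
    exact sum_congr rfl fun _ _ => by simp [mul_comm]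
  rw [hp]
  refine h2.congr_fun fun m => ?_
  rw [mul_sum, mul_sum]
  refine sum_congr rfl fun b _ => ?_
  rw [show ((m + (b + (p + 1)) : ℕ) - b : ℝ) = (p + 1 + m : ℕ) by push_cast; ring,
    show m + (b + (p + 1)) = p + 1 + m + b by ring]
  ring

/-! ### The Fourier cosine series -/

theorem cosh_sub_cos_eq (η ψ : ℝ) :
    Real.cosh η - Real.cos ψ =
      Complex.normSq (1 + (-Real.exp (-η) : ℝ) * Complex.exp (ψ * Complex.I)) /
        (2 * Real.exp (-η)) := by
  have hq := Real.exp_pos (-η)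
  rw [cosh_eq_exp_neg, Complex.normSq_apply]
  simp only [Complex.add_re, Complex.add_im, Complex.re_ofReal_mul, Complex.im_ofReal_mul,
    Complex.exp_ofReal_mul_I_re, Complex.exp_ofReal_mul_I_im, Complex.one_re, Complex.one_im]
  field_simp
  linear_combination (-Real.exp (-η) ^ 2) * Real.sin_sq_add_cos_sq ψ

theorem cosh_sub_cos_pow {η : ℝ} (hη : 0 < η) (ψ : ℝ) (p : ℕ) :
    (Real.cosh η - Real.cos ψ) ^ p =
      Real.sinh η ^ p * ∑ n ∈ range (p + 1),
        neumannFactor n * Real.cos (n * ψ) *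
          ((ascPochhammer ℝ n).eval (-(p : ℝ)) * ((p - n).factorial : ℝ)
            / ((p + n).factorial : ℝ)) * assocLegendreP p n (hypCoth η) := by
  have hq := Real.exp_pos (-η)
  have h := hasSum_cos_of_hasSum p
    (hasSum_choose p (((-Real.exp (-η) : ℝ) : ℂ) * Complex.exp (ψ * Complex.I)))
  -- `p.choose a = 0` for `a > p`, so that the series over the frequencies above `p` vanishes
  have h0 := h.unique (hasSum_zero.congr_fun fun m => by
    rw [sum_eq_zero, mul_zero, mul_zero]
    intro j _
    rw [Nat.choose_eq_zero_of_lt (show p < p + 1 + m + j by omega)]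
    simp)
  have hP : (1 + ((-Real.exp (-η) : ℝ) : ℂ) * Complex.exp (ψ * Complex.I)) ^ p *
      (1 + starRingEnd ℂ (((-Real.exp (-η) : ℝ) : ℂ) * Complex.exp (ψ * Complex.I))) ^ p =
      ((Complex.normSq (1 + (-Real.exp (-η) : ℝ) * Complex.exp (ψ * Complex.I)) ^ p : ℝ) : ℂ) := by
    rw [← mul_pow, Complex.ofReal_pow, ← Complex.mul_conj, map_add, map_one]
  rw [hP, Complex.ofReal_re] at h0
  rw [cosh_sub_cos_eq, sinh_eq_exp_neg, div_pow, div_pow, sub_eq_zero.1 h0, div_mul_eq_mul_div,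
    mul_sum]
  congr 1
  refine sum_congr rfl fun n hn => ?_
  have hn := mem_range_succ_iff.1 hn
  have e := sum_choose_mul_choose_eq_pos hη hn
  have e2 : ∑ j ∈ range (p + 1), (p.choose (n + j) : ℝ) * (p.choose j * (Real.exp (-η) ^ 2) ^ j) =
      ∑ j ∈ range (p + 1), (p.choose j : ℝ) * (p.choose (n + j) * (Real.exp (-η) ^ 2) ^ j) :=
    sum_congr rfl fun _ _ => by ring
  have e3 : (ascPochhammer ℝ n).eval (-(p : ℝ)) * ((p - n).factorial : ℝ) =
      (-1) ^ n * p.factorial := by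
    rw [ascPochhammer_eval_neg_eq_descPochhammer, descPochhammer_eval_eq_descFactorial, mul_assoc,
      mul_comm (p.descFactorial n : ℝ), ← Nat.cast_mul, Nat.factorial_mul_descFactorial hn]
  rw [e3, neg_sq, e2, neg_pow]
  linear_combination (neumannFactor n * Real.cos (n * ψ) * (-1) ^ n) * e

theorem norm_neg_exp_neg_mul_exp_lt_one {η : ℝ} (hη : 0 < η) (ψ : ℝ) :
    ‖((-Real.exp (-η) : ℝ) : ℂ) * Complex.exp (ψ * Complex.I)‖ < 1 := by
  rw [norm_mul, Complex.norm_exp_ofReal_mul_I, Complex.norm_real, norm_neg, mul_one,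
    Real.norm_of_nonneg (Real.exp_pos _).le]
  exact Real.exp_lt_one_iff.2 (by linarith)

theorem log_cosh_sub_cos {η : ℝ} (hη : 0 < η) (ψ : ℝ) :
    Real.log (Real.cosh η - Real.cos ψ) = (η - Real.log 2) + 2 *
      (Complex.log (1 + (-Real.exp (-η) : ℝ) * Complex.exp (ψ * Complex.I))).re := by
  have hW : 1 + ((-Real.exp (-η) : ℝ) : ℂ) * Complex.exp (ψ * Complex.I) ≠ 0 := by
    intro h
    have h1 := norm_neg_exp_neg_mul_exp_lt_one hη ψ
    rw [← neg_eq_of_add_eq_zero_right h] at h1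
    simp at h1
  rw [cosh_sub_cos_eq, Complex.log_re, Complex.normSq_eq_norm_sq,
    Real.log_div (pow_ne_zero _ (norm_ne_zero_iff.2 hW)) (by positivity), Real.log_pow,
    Real.log_mul two_ne_zero (Real.exp_ne_zero _), Real.log_exp]
  push_cast
  ring

/-- The Fourier coefficient of index `n ≤ p`, up to the factor `(-1) ^ n * sinh η ^ p` and the
Neumann factor, of `(cosh η - cos ψ) ^ p * (log (cosh η - cos ψ) - (η - log 2))`. -/
noncomputable def logCoeff (p : ℕ) (η : ℝ) (n : ℕ) : ℝ :=
  p.factorial / (p - n).factorial *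
        (((harmonic (2 * p) : ℝ) - harmonic (p - n)) * assocLegendreP p (-(n : ℤ)) (hypCoth η) +
          (-1) ^ p * ∑ l ∈ range p,
            degreeWeight p l * assocLegendreP l (-(n : ℤ)) (hypCoth η)) +
  p.factorial / (p + n).factorial *
        (((harmonic (2 * p) : ℝ) - harmonic (p + n)) * assocLegendreP p n (hypCoth η) +
          (-1) ^ p * ∑ l ∈ range p, degreeWeight p l * assocLegendreP l n (hypCoth η))

/-- The series over the frequencies `n = p + 1 + m`, with its value. -/
theorem hasSum_tail {η : ℝ} (hη : 0 < η) (ψ : ℝ) (p : ℕ) :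
    HasSum (fun m : ℕ =>
      2 * (-1 : ℝ) ^ (p + 1) * p.factorial * Real.sinh η ^ p *
        (Real.cos (((p + 1 + m : ℕ) : ℝ) * ψ) * (m.factorial : ℝ) *
        assocLegendreP p (-((p + 1 + m : ℕ) : ℤ)) (hypCoth η)))
      ((Real.cosh η - Real.cos ψ) ^ p * Real.log (Real.cosh η - Real.cos ψ) -
        (η - Real.log 2) * (Real.cosh η - Real.cos ψ) ^ p - Real.sinh η ^ p *
        ∑ n ∈ range (p + 1), neumannFactor n * Real.cos (n * ψ) * ((-1) ^ n * logCoeff p η n)) := by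
  have hq := Real.exp_pos (-η)
  have hw := norm_neg_exp_neg_mul_exp_lt_one hη ψ
  have h := (hasSum_cos_of_hasSum p (hasSum_logBinom p hw)).mul_left (2 / (2 * Real.exp (-η)) ^ p)
  set W := 1 + ((-Real.exp (-η) : ℝ) : ℂ) * Complex.exp (ψ * Complex.I) with hW
  have hP : W ^ p * Complex.log W *
      (1 + starRingEnd ℂ (((-Real.exp (-η) : ℝ) : ℂ) * Complex.exp (ψ * Complex.I))) ^ p =
      ((Complex.normSq W ^ p : ℝ) : ℂ) * Complex.log W := by
    rw [mul_right_comm, ← mul_pow, Complex.ofReal_pow, ← Complex.mul_conj, hW, map_add, map_one]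
  rw [hP, Complex.re_ofReal_mul] at h
  have hS : ∑ n ∈ range (p + 1), neumannFactor n / 2 * Real.cos (n * ψ) * ((-Real.exp (-η)) ^ n *
      (∑ j ∈ range (p + 1), (p.choose j : ℝ) *
          (logBinom p (n + j) * ((-Real.exp (-η)) ^ 2) ^ j) +
        ∑ j ∈ range (p + 1), (p.choose (n + j) : ℝ) *
          (logBinom p j * ((-Real.exp (-η)) ^ 2) ^ j))) =
      (1 - Real.exp (-η) ^ 2) ^ p / 2 *
      ∑ n ∈ range (p + 1), neumannFactor n * Real.cos (n * ψ) * ((-1) ^ n * logCoeff p η n) := by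
    rw [mul_sum]
    refine sum_congr rfl fun n hn => ?_
    have hn := mem_range_succ_iff.1 hn
    rw [neg_sq, neg_pow, logCoeff]
    linear_combination (neumannFactor n / 2 * Real.cos (n * ψ) * (-1) ^ n) *
      (sum_choose_mul_logBinom hη hn + sum_choose_add_mul_logBinom hη hn)
  rw [hS] at h
  have hv : (Real.cosh η - Real.cos ψ) ^ p * Real.log (Real.cosh η - Real.cos ψ) -
        (η - Real.log 2) * (Real.cosh η - Real.cos ψ) ^ p - Real.sinh η ^ p *
        ∑ n ∈ range (p + 1), neumannFactor n * Real.cos (n * ψ) * ((-1) ^ n * logCoeff p η n) =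
      2 / (2 * Real.exp (-η)) ^ p * (Complex.normSq W ^ p * (Complex.log W).re -
        (1 - Real.exp (-η) ^ 2) ^ p / 2 *
      ∑ n ∈ range (p + 1), neumannFactor n * Real.cos (n * ψ) * ((-1) ^ n * logCoeff p η n)) := by
    rw [log_cosh_sub_cos hη, cosh_sub_cos_eq, sinh_eq_exp_neg, div_pow, div_pow]
    ring
  rw [hv]
  refine h.congr_fun fun m => ?_
  have e := sum_choose_mul_logBinom_of_lt hη p m
  have h1 : (-1 : ℝ) ^ (p + 1 + m) * (-1) ^ m = (-1) ^ (p + 1) := by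
    rw [pow_add, mul_assoc, ← mul_pow]; simp
  rw [neg_sq, neg_pow, sinh_eq_exp_neg, div_pow, ← h1]
  linear_combination (-2 / (2 * Real.exp (-η)) ^ p * Real.cos ((p + 1 + m : ℕ) * ψ) *
    (-1) ^ (p + 1 + m)) * e

/-- In the sum over the degrees `l < p`, those with `l ≥ n` are expressed through the order `n`;
those with `l < n` occur with the order `-n` only. -/
theorem logCoeff_eq {η : ℝ} (hη : 0 < η) {n p : ℕ} (hn : n ≤ p) :
    (-1) ^ n * logCoeff p η n =
      p.factorial * ((-1 : ℝ) ^ n / ((p + n).factorial : ℝ) *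
        (2 * realDigamma (2 * p + 1) - realDigamma (p + 1 + n) - realDigamma (p + 1 - n)) *
          assocLegendreP p n (hypCoth η)) +
      (-1) ^ p * p.factorial * (1 / ((p + n).factorial : ℝ) *
        ∑ k ∈ range (p - n), (-1 : ℝ) ^ k * (2 * n + 2 * k + 1) *
          (1 + (k.factorial : ℝ) * ((p + n).factorial : ℝ)
            / (((2 * n + k).factorial : ℝ) * ((p - n).factorial : ℝ)))
          / (((p : ℝ) - n - k) * ((p : ℝ) + n + k + 1)) * assocLegendreP (n + k) n (hypCoth η)) +
      (-1) ^ p * p.factorial * ((-1 : ℝ) ^ n / ((p - n).factorial : ℝ) *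
        ∑ k ∈ range n, (-1 : ℝ) ^ k * (2 * k + 1) / (((p : ℝ) - k) * ((p : ℝ) + k + 1)) *
          assocLegendreP k (-(n : ℤ)) (hypCoth η)) := by
  have d1 : realDigamma (2 * p + 1) = harmonic (2 * p) - Real.eulerMascheroniConstant := by
    have := realDigamma_natCast_add_one (2 * p)
    push_cast at this
    exact this
  have d2 : realDigamma (p + 1 + n) = harmonic (p + n) - Real.eulerMascheroniConstant := by
    rw [← realDigamma_natCast_add_one]
    congr 1
    push_cast
    ring
  have d3 : realDigamma (p + 1 - n) = harmonic (p - n) - Real.eulerMascheroniConstant := by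
    rw [← realDigamma_natCast_add_one]
    congr 1
    push_cast [hn]
    ring
  have hU : ∑ l ∈ range p, degreeWeight p l * assocLegendreP l (-(n : ℤ)) (hypCoth η) =
      ∑ l ∈ range n, degreeWeight p l * assocLegendreP l (-(n : ℤ)) (hypCoth η) +
      ∑ k ∈ range (p - n), degreeWeight p (n + k) * (k.factorial / (2 * n + k).factorial *
        assocLegendreP (n + k) n (hypCoth η)) := by
    conv_lhs => rw [← Nat.add_sub_cancel' hn, sum_range_add]
    rw [Nat.add_sub_cancel' hn]
    congr 1
    refine sum_congr rfl fun k _ => ?_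
    rw [assocLegendreP_natCast_eq_neg hη (Nat.le_add_right n k), Nat.add_sub_cancel_left,
      show n + k + n = 2 * n + k by ring]
    field_simp
  have hV : ∑ l ∈ range p, degreeWeight p l * assocLegendreP l n (hypCoth η) =
      ∑ k ∈ range (p - n), degreeWeight p (n + k) * assocLegendreP (n + k) n (hypCoth η) := by
    conv_lhs => rw [← Nat.add_sub_cancel' hn, sum_range_add]
    rw [Nat.add_sub_cancel' hn, add_eq_right]
    refine sum_eq_zero fun l hl => ?_
    rw [assocLegendreP_natCast_of_lt hη (mem_range.1 hl), mul_zero]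
  have hS : ∑ k ∈ range (p - n), (-1 : ℝ) ^ k * (2 * n + 2 * k + 1) *
          (1 + (k.factorial : ℝ) * ((p + n).factorial : ℝ)
            / (((2 * n + k).factorial : ℝ) * ((p - n).factorial : ℝ)))
          / (((p : ℝ) - n - k) * ((p : ℝ) + n + k + 1)) * assocLegendreP (n + k) n (hypCoth η) =
      (-1) ^ n * (∑ k ∈ range (p - n), degreeWeight p (n + k) *
          assocLegendreP (n + k) n (hypCoth η) +
        (p + n).factorial / (p - n).factorial * ∑ k ∈ range (p - n), degreeWeight p (n + k) *
          (k.factorial / (2 * n + k).factorial * assocLegendreP (n + k) n (hypCoth η))) := by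
    rw [mul_sum, ← sum_add_distrib, mul_sum]
    refine sum_congr rfl fun k _ => ?_
    have h1 : (-1 : ℝ) ^ n * (-1) ^ n = 1 := by rw [← mul_pow]; simp
    rw [degreeWeight, pow_add]
    push_cast
    simp only [div_eq_mul_inv, mul_inv]
    rw [show (p : ℝ) - n - k = p - (n + k) by ring,
      show (p : ℝ) + n + k + 1 = p + (n + k) + 1 by ring]
    linear_combination (-(-1 : ℝ) ^ k * (2 * n + 2 * k + 1) *
      (1 + (k.factorial : ℝ) * ((p + n).factorial : ℝ)
        * (((2 * n + k).factorial : ℝ)⁻¹ * ((p - n).factorial : ℝ)⁻¹))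
        * (((p : ℝ) - (n + k))⁻¹ * ((p : ℝ) + (n + k) + 1)⁻¹) *
          assocLegendreP (n + k) n (hypCoth η)) * h1
  have hW : ∑ k ∈ range n, (-1 : ℝ) ^ k * (2 * k + 1) / (((p : ℝ) - k) * ((p : ℝ) + k + 1)) *
          assocLegendreP k (-(n : ℤ)) (hypCoth η) =
      ∑ l ∈ range n, degreeWeight p l * assocLegendreP l (-(n : ℤ)) (hypCoth η) := rfl
  rw [hS, hW, d1, d2, d3, logCoeff, hU, hV, assocLegendreP_natCast_eq_neg hη hn]
  have := (p - n).factorial_ne_zero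
  have := (p + n).factorial_ne_zero
  field_simp
  ring

theorem sum_Icc_one_eq_sum_neumannFactor {p : ℕ} {c : ℕ → ℝ} (h : c 0 = 0) :
    ∑ n ∈ Icc 1 p, c n = ∑ n ∈ range (p + 1), neumannFactor n / 2 * c n := by
  rw [sum_range_succ', h, mul_zero, add_zero, range_eq_Ico,
    sum_Ico_add' (fun n : ℕ => neumannFactor n / 2 * c n) 0 p 1, zero_add,
    Ico_add_one_right_eq_Icc]
  refine sum_congr rfl fun n hn => ?_
  rw [neumannFactor, if_neg (Nat.one_le_iff_ne_zero.1 (mem_Icc.1 hn).1), div_self two_ne_zero,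
    one_mul]

theorem mainTheorem1 (p : ℕ) (η : ℝ) (hη : 0 < η) (ψ : ℝ) :
    -- the Fourier cosine series of the power
    (Real.cosh η - Real.cos ψ) ^ p =
      Real.sinh η ^ p * ∑ n ∈ Finset.range (p + 1),
        neumannFactor n * Real.cos (n * ψ) *
          ((ascPochhammer ℝ n).eval (-(p : ℝ)) * ((p - n).factorial : ℝ)
            / ((p + n).factorial : ℝ)) *
          assocLegendreP p n (hypCoth η)
    ∧
    -- the terms with `n = p + 1 + m`, `m ∈ ℕ₀`, form an absolutely convergent series
    Summable (fun m : ℕ =>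
      Real.cos (((p + 1 + m : ℕ) : ℝ) * ψ) * (m.factorial : ℝ) *
        assocLegendreP p (-((p + 1 + m : ℕ) : ℤ)) (hypCoth η))
    ∧
    (Real.cosh η - Real.cos ψ) ^ p * Real.log (Real.cosh η - Real.cos ψ) =
      (η - Real.log 2) * (Real.cosh η - Real.cos ψ) ^ p
      + (p.factorial : ℝ) * Real.sinh η ^ p *
          ∑ n ∈ Finset.range (p + 1),
            (-1 : ℝ) ^ n * neumannFactor n * Real.cos (n * ψ) / ((p + n).factorial : ℝ) *
              (2 * realDigamma (2 * p + 1) - realDigamma (p + 1 + n) - realDigamma (p + 1 - n)) *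
              assocLegendreP p n (hypCoth η)
      + (-1 : ℝ) ^ p * (p.factorial : ℝ) * Real.sinh η ^ p *
          ∑ n ∈ Finset.range p,
            neumannFactor n * Real.cos (n * ψ) / ((p + n).factorial : ℝ) *
              ∑ k ∈ Finset.range (p - n),
                (-1 : ℝ) ^ k * (2 * n + 2 * k + 1) *
                  (1 + (k.factorial : ℝ) * ((p + n).factorial : ℝ)
                    / (((2 * n + k).factorial : ℝ) * ((p - n).factorial : ℝ)))
                  / (((p : ℝ) - n - k) * ((p : ℝ) + n + k + 1)) *
                  assocLegendreP (n + k) n (hypCoth η)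
      + 2 * (-1 : ℝ) ^ p * (p.factorial : ℝ) * Real.sinh η ^ p *
          ∑ n ∈ Finset.Icc 1 p,
            (-1 : ℝ) ^ n * Real.cos (n * ψ) / ((p - n).factorial : ℝ) *
              ∑ k ∈ Finset.range n,
                (-1 : ℝ) ^ k * (2 * k + 1) / (((p : ℝ) - k) * ((p : ℝ) + k + 1)) *
                  assocLegendreP k (-(n : ℤ)) (hypCoth η)
      + 2 * (-1 : ℝ) ^ (p + 1) * (p.factorial : ℝ) * Real.sinh η ^ p *
          ∑' m : ℕ,
            Real.cos (((p + 1 + m : ℕ) : ℝ) * ψ) * (m.factorial : ℝ) *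
              assocLegendreP p (-((p + 1 + m : ℕ) : ℤ)) (hypCoth η) := by

  have hT := hasSum_tail hη ψ p
  have hc : 2 * (-1 : ℝ) ^ (p + 1) * p.factorial * Real.sinh η ^ p ≠ 0 := by
    have := Real.sinh_pos_iff.2 hη
    positivity
  refine ⟨cosh_sub_cos_pow hη ψ p, (summable_mul_left_iff hc).1 hT.summable, ?_⟩
  have hsum := hT.tsum_eq
  rw [tsum_mul_left] at hsum
  have h2 : ∀ c : ℕ → ℝ, c p = 0 → ∑ n ∈ range p, c n = ∑ n ∈ range (p + 1), c n := by
    intro c hc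
    rw [sum_range_succ, hc, add_zero]
  have h3 : ∀ A E S a b c : ℝ, S = a + b + c → A = E + a + b + c + (A - E - S) := by
    rintro A E _ a b c rfl
    ring
  -- the summands added at `n = p` and `n = 0` contain empty sums
  rw [h2, sum_Icc_one_eq_sum_neumannFactor, hsum]
  · refine h3 _ _ _ _ _ _ ?_
    rw [mul_sum, mul_sum, mul_sum, mul_sum, ← sum_add_distrib, ← sum_add_distrib]
    refine sum_congr rfl fun n hn => ?_
    rw [logCoeff_eq hη (mem_range_succ_iff.1 hn)]
    ring
  · simp
  · simp
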